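/- For a nonzero integer $r$ define the $r$-Fishburn numbers $\xi_r(n)$, $n\ge 0$, by the formal power series identity $$\sum_{n=0}^\infty \xi_r(n)\,q^n = F\big((1-q)^r\big),\qquad F(q)=\sum_{n=0}^\infty (q;q)_n,\qquad (a;q)_n=\prod_{i=0}^{n-1}(1-aq^i),$$ where for $r<0$ the power $(1-q)^r$ is taken in $\mathbb{Z}[[q]]$. For a prime $p\ge 5$, a nonzero integer $r$ coprime to $p$, and $0\le s\le p-1$ let $$S^*(p,r,s)=\Big\{\,j : 0\le j\le p-1,\ \tfrac12 r n(3n-1)\equiv j-s \pmod p \text{ for some integer } n,\ \text{and } 24(j-s)\not\equiv -r \pmod p\Big\},$$ $$T^*(p,r,s)=\big\{\,k : 0\le k\le p-1,\ k>j \text{ for every } j\in S^*(p,r,s)\big\}.$$ Corollary. Suppose $p\ge 5$ is prime and $r$ is a nonzero integer relatively prime to $p$. If $m\in T^*(p,r,0)$, then for all $n\ge 0$, $$\xi_r(pn+m)\equiv 0 \pmod p.$$ -/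

import Mathlib

namespace Fishburn

open scoped PowerSeries PowerSeries.WithPiTopology

noncomputable section

/-- The `q`-shifted factorial `(a; q)_n = (1 - a)(1 - a q) ⋯ (1 - a q ^ (n - 1))`. -/
def qPoch {R : Type*} [CommRing R] (a q : R) (n : ℕ) : R :=
  ∏ i ∈ Finset.range n, (1 - a * q ^ i)

/-- The series `F(Q) = ∑_{n ≥ 0} (Q; Q)_n`, for a formal power series `Q` over `ℤ`. The sum is taken
in the topology of coefficientwise convergence (`ℤ` being discrete); it converges if `Q` has
constant term `1`, see `hasSum_F`. -/
def F (Q : ℤ⟦X⟧) : ℤ⟦X⟧ := ∑' n : ℕ, qPoch Q Q n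

/-- `1 - q` as an invertible formal power series over `ℤ`, with inverse `1 + q + q ^ 2 + ⋯`. -/
def oneSubX : (ℤ⟦X⟧)ˣ where
  val := 1 - PowerSeries.X
  inv := PowerSeries.mk 1
  val_inv := by
    rw [mul_comm]; exact PowerSeries.mk_one_mul_one_sub_eq_one ℤ
  inv_val := PowerSeries.mk_one_mul_one_sub_eq_one ℤ

/-- The `r`-Fishburn number `ξ_r(n)`: the coefficient of `q ^ n` in `F((1 - q) ^ r)`. -/
def xi (r : ℤ) (n : ℕ) : ℤ :=
  PowerSeries.coeff n (F ((oneSubX ^ r : (ℤ⟦X⟧)ˣ) : ℤ⟦X⟧))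

/-- The set `S*(p, r, s)`. The division by `2` is exact, since `n (3 n - 1)` is even. -/
def SStar (p : ℕ) (r : ℤ) (s : ℕ) : Set ℕ :=
  {j | j ≤ p - 1 ∧ (∃ n : ℤ, r * (n * (3 * n - 1) / 2) ≡ (j : ℤ) - (s : ℤ) [ZMOD (p : ℤ)]) ∧
    ¬ 24 * ((j : ℤ) - (s : ℤ)) ≡ -r [ZMOD (p : ℤ)]}

/-- The set `T*(p, r, s)`. -/
def TStar (p : ℕ) (r : ℤ) (s : ℕ) : Set ℕ :=
  {k | k ≤ p - 1 ∧ ∀ j ∈ SStar p r s, j < k}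

theorem X_pow_dvd_qPoch {Q : ℤ⟦X⟧} (hQ : PowerSeries.constantCoeff Q = 1) (n : ℕ) :
    PowerSeries.X ^ n ∣ qPoch Q Q n := by
  have h : ∏ _i ∈ Finset.range n, (PowerSeries.X : ℤ⟦X⟧) ∣ qPoch Q Q n := by
    refine Finset.prod_dvd_prod_of_dvd _ _ fun i _ => ?_
    rw [PowerSeries.X_dvd_iff]
    simp [hQ]
  simpa using h

/-- If `Q` has constant term `1`, then the series `F(Q)` converges. -/
theorem hasSum_F {Q : ℤ⟦X⟧} (hQ : PowerSeries.constantCoeff Q = 1) :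
    HasSum (fun n : ℕ => qPoch Q Q n) (F Q) := by
  refine Summable.hasSum ?_
  refine ⟨PowerSeries.mk fun N => ∑ n ∈ Finset.range (N + 1), PowerSeries.coeff N (qPoch Q Q n), ?_⟩
  rw [PowerSeries.WithPiTopology.hasSum_iff_hasSum_coeff]
  intro N
  rw [PowerSeries.coeff_mk]
  refine hasSum_sum_of_ne_finset_zero fun n hn => ?_
  refine PowerSeries.X_pow_dvd_iff.mp (X_pow_dvd_qPoch hQ n) N ?_
  simpa using hn

/-- `(1 - q) ^ r` has constant term `1`, so `hasSum_F` applies to it. -/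
theorem constantCoeff_oneSubX_zpow (r : ℤ) :
    PowerSeries.constantCoeff ((oneSubX ^ r : (ℤ⟦X⟧)ˣ) : ℤ⟦X⟧) = 1 := by
  have h : Units.map (PowerSeries.constantCoeff (R := ℤ) : ℤ⟦X⟧ →* ℤ) oneSubX = 1 := by
    ext; simp [oneSubX]
  have h2 : Units.map (PowerSeries.constantCoeff (R := ℤ) : ℤ⟦X⟧ →* ℤ) (oneSubX ^ r) = 1 := by
    rw [map_zpow, h, one_zpow]
  exact congrArg Units.val h2

end

end Fishburn

namespace Fishburn

open PowerSeries

/-! Take `N = p ^ a` above the coefficient index. By Frobenius, `(1 - X) ^ N = 1` in `𝔽_p[[X]]/(X ^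
N)`, so there `(1 - X) ^ r` is an `N`-th root of unity, and `r` may be replaced by a natural number
`s ≡ r` mod `N`. At such roots, over any commutative ring, the strange identity `two_mul_sum_qPoch`
turns `2 F` into a finite sum of pentagonal powers with weights `±(6k + 5)` mod `p`. The
coefficients are then binomials (`two_mul_xi_cast`). Terms with `p ∣ 6k + 5` have weight zero; in
the others the top entry mod `p` lies in `S*`, hence below `m`, and Lucas's theorem kills the
binomial. -/

theorem qPoch_succ {R : Type*} [CommRing R] (a q : R) (n : ℕ) :
    qPoch a q (n + 1) = qPoch a q n * (1 - a * q ^ n) :=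
  Finset.prod_range_succ _ _

theorem qPoch_succ' {R : Type*} [CommRing R] (a q : R) (n : ℕ) :
    qPoch a q (n + 1) = (1 - a) * qPoch (q * a) q n := by
  simp only [qPoch]
  rw [Finset.prod_range_succ', mul_comm]
  congr 1
  · simp
  · exact Finset.prod_congr rfl fun i _ => by ring

theorem map_qPoch {R S : Type*} [CommRing R] [CommRing S] (f : R →+* S) (a q : R) (n : ℕ) :
    f (qPoch a q n) = qPoch (f a) (f q) n := by
  simp [qPoch, map_prod]

/-- The partial sums of `∑ (t; q)_{n + 1} t ^ n`. -/
def zagierSum {R : Type*} [CommRing R] (q t : R) (K : ℕ) : R :=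
  ∑ n ∈ Finset.range K, qPoch t q (n + 1) * t ^ n

/-- Zagier's functional equation, with its remainder for the partial sums. -/
theorem zagierSum_eq {R : Type*} [CommRing R] (q t : R) (K : ℕ) :
    zagierSum q t K = 1 - q * t ^ 2 - q ^ 2 * t ^ 3 * zagierSum q (q * t) K
      + qPoch (q * t) q K * (t ^ (K + 1) - t ^ K - t ^ (K + 1) * (1 - q * t * q ^ K)) := by
  induction K with
  | zero => simp [zagierSum, qPoch]; ring
  | succ K ih =>
    simp only [zagierSum] at ih ⊢
    rw [Finset.sum_range_succ, Finset.sum_range_succ, ih, qPoch_succ' t, qPoch_succ (q * t)]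
    ring

theorem zagierSum_eq_of_qPoch_eq_zero {R : Type*} [CommRing R] {q t : R} {K : ℕ}
    (h : qPoch (q * t) q K = 0) :
    zagierSum q t K = 1 - q * t ^ 2 - q ^ 2 * t ^ 3 * zagierSum q (q * t) K := by
  rw [zagierSum_eq, h]; ring

/-! ### The strange identity at roots of unity -/

theorem qPoch_add {R : Type*} [CommRing R] (a q : R) (m n : ℕ) :
    qPoch a q (m + n) = qPoch a q m * qPoch (a * q ^ m) q n := by
  simp only [qPoch, Finset.prod_range_add]
  congr 1
  exact Finset.prod_congr rfl fun i _ => by ring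

/-- Among `N` consecutive exponents of `q` one is a multiple of `N`. -/
theorem one_sub_dvd_qPoch {R : Type*} [CommRing R] {q : R} {N : ℕ} (hN : 0 < N)
    (hq : q ^ N = 1) (x : R) (k : ℕ) : 1 - x ∣ qPoch (q ^ k * x) q N := by
  have h : (k + (N - k % N) % N) % N = 0 := by
    rw [Nat.add_mod_mod, ← Nat.mod_add_mod, Nat.add_sub_cancel' (Nat.mod_lt k hN).le, Nat.mod_self]
  have h2 : q ^ k * x * q ^ ((N - k % N) % N) = x := by
    rw [mul_right_comm, ← pow_add, ← Nat.div_add_mod (k + (N - k % N) % N) N, h, add_zero,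
      pow_mul, hq, one_pow, one_mul]
  have h3 := Finset.dvd_prod_of_mem (fun i => 1 - q ^ k * x * q ^ i)
    (Finset.mem_range.mpr (Nat.mod_lt (N - k % N) hN))
  rw [h2] at h3
  exact h3

theorem qPoch_self_eq_zero {R : Type*} [CommRing R] {q : R} {N n : ℕ} (hN : 0 < N)
    (hq : q ^ N = 1) (hn : N ≤ n) : qPoch q q n = 0 := by
  obtain ⟨d, rfl⟩ := Nat.exists_eq_add_of_le hn
  have h := one_sub_dvd_qPoch hN hq 1 1
  rw [sub_self, zero_dvd_iff, pow_one, mul_one] at h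
  rw [qPoch_add, h, zero_mul]

theorem pentagonal_add (k : ℕ) :
    (k + 1) * (3 * k + 2) / 2 = k * (3 * k + 1) / 2 + (2 * k + 1) := by
  rw [← Nat.add_mul_div_left _ _ two_pos]
  congr 1
  ring

theorem pentagonal_succ (k : ℕ) :
    (k + 1) * (3 * (k + 1) + 1) / 2 = k * (3 * k + 1) / 2 + (3 * k + 2) := by
  rw [← Nat.add_mul_div_left _ _ two_pos]
  congr 1
  ring

theorem two_dvd_pentagonal (k : ℕ) : 2 ∣ (k + 1) * (3 * k + 2) := by
  rcases Nat.even_or_odd' k with ⟨c, rfl | rfl⟩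
  · exact Dvd.dvd.mul_left ⟨3 * c + 1, by ring⟩ _
  · exact Dvd.dvd.mul_right ⟨c + 1, by ring⟩ _

/-- Since `N - 1 - k ≡ -(k + 1)` mod `N`, the doubled exponents agree mod `N`; `N` odd allows
cancelling the 2. -/
theorem pow_pentagonal_reflect {R : Type*} [CommRing R] {q : R} {N k : ℕ} (hN : Odd N)
    (hq : q ^ N = 1) (hk : k < N) :
    q ^ ((N - 1 - k) * (3 * (N - 1 - k) + 1) / 2) = q ^ ((k + 1) * (3 * k + 2) / 2) := by
  obtain ⟨d, rfl⟩ : ∃ d, N = k + 1 + d := ⟨N - 1 - k, by omega⟩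
  have hd : k + 1 + d - 1 - k = d := by omega
  rw [hd]
  obtain ⟨c, hc⟩ := hN
  obtain ⟨e, he⟩ := two_dvd_pentagonal k
  have h2 : d * (3 * d + 1) + (k + 1 + d) * (3 * (k + 1)) =
      (k + 1) * (3 * k + 2) + (k + 1 + d) * (3 * d + 1) := by ring
  have key : ∀ a b : ℕ, a ≡ b [MOD k + 1 + d] → q ^ a = q ^ b := by
    intro a b h
    rw [← Nat.div_add_mod a (k + 1 + d), ← Nat.div_add_mod b (k + 1 + d), pow_add, pow_add,
      pow_mul, pow_mul, hq, one_pow, one_pow, h]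
  apply key
  have hco : Nat.gcd (k + 1 + d) 2 = 1 := by
    rw [hc]; simp
  apply Nat.ModEq.cancel_left_of_coprime hco
  have hd2 : 2 ∣ d * (3 * d + 1) := by
    rcases Nat.even_or_odd' d with ⟨c, rfl | rfl⟩
    · exact Dvd.dvd.mul_right ⟨c, rfl⟩ _
    · exact Dvd.dvd.mul_left ⟨3 * c + 2, by ring⟩ _
  rw [Nat.mul_div_cancel' hd2, Nat.mul_div_cancel' (two_dvd_pentagonal k)]
  have h3 := congrArg (· % (k + 1 + d)) h2
  simpa [Nat.ModEq] using h3

theorem zagierSum_iterate {R : Type*} [CommRing R] {q x : R} {K : ℕ}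
    (h : ∀ k, qPoch (q ^ k * x) q K = 0) (M : ℕ) :
    zagierSum q x K =
      ∑ k ∈ Finset.range M, (-1) ^ k * (q ^ (k * (3 * k + 1) / 2) * x ^ (3 * k)
        - q ^ ((k + 1) * (3 * k + 2) / 2) * x ^ (3 * k + 2))
      + (-1) ^ M * q ^ (M * (3 * M + 1) / 2) * x ^ (3 * M) * zagierSum q (q ^ M * x) K := by
  induction M with
  | zero => simp
  | succ M ih =>
    have h1 := h (M + 1)
    rw [pow_succ', mul_assoc] at h1
    rw [ih, zagierSum_eq_of_qPoch_eq_zero h1, Finset.sum_range_succ, pentagonal_add,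
      pentagonal_succ, pow_succ' q M, mul_assoc q]
    ring

theorem one_add_pow_of_sq_eq_zero {R : Type*} [CommRing R] {e : R} (he : e ^ 2 = 0) (n : ℕ) :
    (1 + e) ^ n = 1 + n * e := by
  induction n with
  | zero => simp
  | succ n ih =>
    rw [pow_succ, ih]
    push_cast
    linear_combination (n : R) * he

/-- This differentiates Zagier's equation at `t = 1`: the factor `1 - t = -e` leaves only the values
at `t = 1` of the other factors. -/
theorem eps_mul_two_mul_sum_qPoch {R : Type*} [CommRing R] {q e : R} {N : ℕ} (hN : Odd N)
    (hq : q ^ N = 1) (he : e ^ 2 = 0) :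
    -(2 * e * ∑ n ∈ Finset.range N, qPoch q q n) =
      ∑ k ∈ Finset.range N, (-1) ^ k * (q ^ (k * (3 * k + 1) / 2) * (1 + (3 * k : ℕ) * e)
        - q ^ ((k + 1) * (3 * k + 2) / 2) * (1 + (3 * k + 2 : ℕ) * e)) := by
  have hpos : 0 < N := hN.pos
  -- Each of the two periods contributes a factor `e`, hence length `2N`.
  have hvan : ∀ k, qPoch (q ^ k * (1 + e)) q (N + N) = 0 := by
    intro k
    rw [qPoch_add, mul_assoc, mul_comm _ (q ^ N), hq, one_mul]
    obtain ⟨c, hc⟩ := one_sub_dvd_qPoch hpos hq (1 + e) k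
    rw [hc]
    linear_combination c ^ 2 * he
  have hS : zagierSum q (1 + e) (N + N) = -(e * ∑ n ∈ Finset.range N, qPoch q q n) := by
    have hterm : ∀ n, qPoch (1 + e) q (n + 1) * (1 + e) ^ n = -(e * qPoch q q n) := by
      intro n
      have hmod : ∀ n, e * qPoch (q * (1 + e)) q n = e * qPoch q q n := by
        intro n
        induction n with
        | zero => simp [qPoch]
        | succ n ih =>
          rw [qPoch_succ, qPoch_succ, ← mul_assoc, ih, ← mul_assoc]
          linear_combination (-qPoch q q n * q * q ^ n) * he
      rw [qPoch_succ', one_add_pow_of_sq_eq_zero he]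
      linear_combination -(1 + n * e) * hmod n - n * qPoch q q n * he
    simp only [zagierSum, hterm]
    rw [Finset.sum_range_add, Finset.sum_neg_distrib, ← Finset.mul_sum]
    rw [Finset.sum_eq_zero (s := Finset.range N) (f := fun n => -(e * qPoch q q (N + n)))
      fun n _ => by rw [qPoch_self_eq_zero hpos hq (Nat.le_add_right N n)]; simp, add_zero]
  have hq2 : q ^ (N * (3 * N + 1) / 2) = 1 := by
    have h2 : 2 ∣ 3 * N + 1 := by
      obtain ⟨c, rfl⟩ := hN
      exact ⟨3 * c + 2, by ring⟩
    rw [Nat.mul_div_assoc _ h2, pow_mul, hq, one_pow]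
  have hit := zagierSum_iterate hvan N
  -- After `N` steps the remainder is minus the original sum, up to a factor `(1 + e) ^ (3N)`
  -- invisible mod `e ^ 2`; this produces the 2.
  rw [hq2, hq, one_mul, hN.neg_one_pow, hS] at hit
  simp only [one_add_pow_of_sq_eq_zero he] at hit
  rw [← sub_eq_zero] at hit
  rw [← sub_eq_zero, ← hit]
  push_cast
  linear_combination (3 * N * ∑ n ∈ Finset.range N, qPoch q q n) * he

/-- Zagier's strange identity at an `N`-th root of unity, for `N` odd. -/
theorem two_mul_sum_qPoch {R : Type*} [CommRing R] {q : R} {N : ℕ} (hN : Odd N)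
    (hq : q ^ N = 1) :
    2 * ∑ n ∈ Finset.range N, qPoch q q n =
      ∑ k ∈ Finset.range N,
        (-1) ^ k * (6 * k + 5 - 3 * N) * q ^ ((k + 1) * (3 * k + 2) / 2) := by
  have hmain : -(2 * ∑ n ∈ Finset.range N, qPoch q q n) =
      ∑ k ∈ Finset.range N, (-1) ^ k * (q ^ (k * (3 * k + 1) / 2) * (3 * k)
        - q ^ ((k + 1) * (3 * k + 2) / 2) * (3 * k + 2)) := by
    let ι : R →+* DualNumber R := algebraMap R (DualNumber R)
    have h := eps_mul_two_mul_sum_qPoch (q := ι q) (e := (DualNumber.eps : DualNumber R)) hN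
      (by rw [← map_pow, hq, map_one]) (by rw [sq, DualNumber.eps_mul_eps])
    have h1 : -(2 * DualNumber.eps * ∑ n ∈ Finset.range N, qPoch (ι q) (ι q) n) =
        ι (-(2 * ∑ n ∈ Finset.range N, qPoch q q n)) * DualNumber.eps := by
      simp only [map_neg, map_mul, map_sum, map_qPoch, map_ofNat]
      ring
    have h2 : ∑ k ∈ Finset.range N,
          (-1) ^ k * (ι q ^ (k * (3 * k + 1) / 2) * (1 + ((3 * k : ℕ) : DualNumber R) * DualNumber.eps)
          - ι q ^ ((k + 1) * (3 * k + 2) / 2) * (1 + ((3 * k + 2 : ℕ) : DualNumber R) * DualNumber.eps)) =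
        ι (∑ k ∈ Finset.range N, (-1) ^ k * (q ^ (k * (3 * k + 1) / 2)
          - q ^ ((k + 1) * (3 * k + 2) / 2))) +
        ι (∑ k ∈ Finset.range N, (-1) ^ k * (q ^ (k * (3 * k + 1) / 2) * (3 * k)
          - q ^ ((k + 1) * (3 * k + 2) / 2) * (3 * k + 2))) * DualNumber.eps := by
      simp only [map_sum, Finset.sum_mul]
      rw [← Finset.sum_add_distrib]
      refine Finset.sum_congr rfl fun k _ => ?_
      simp only [map_mul, map_sub, map_pow, map_neg, map_one, map_add, map_ofNat, map_natCast]
      push_cast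
      ring
    rw [h1, h2] at h
    have hsnd : ∀ a b c : R, ι a * DualNumber.eps = ι b + ι c * DualNumber.eps → a = c := by
      intro a b c h
      simpa [ι, TrivSqZeroExt.algebraMap_eq_inl] using congrArg TrivSqZeroExt.snd h
    exact hsnd _ _ _ h
  rw [← neg_inj, hmain]
  simp only [mul_sub, Finset.sum_sub_distrib]
  rw [← Finset.sum_range_reflect, ← Finset.sum_sub_distrib, ← Finset.sum_neg_distrib]
  refine Finset.sum_congr rfl fun k hk => ?_
  rw [Finset.mem_range] at hk
  rw [pow_pentagonal_reflect hN hq hk]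
  have hsign : (-1 : R) ^ (N - 1 - k) = (-1) ^ k := by
    refine neg_one_pow_congr ?_
    obtain ⟨c, rfl⟩ := hN
    simp only [Nat.even_iff]
    omega
  rw [hsign, Nat.sub_sub, Nat.cast_sub (by omega)]
  push_cast
  ring

/-! ### Reduction modulo `p` and Lucas's theorem -/

theorem coeff_F_eq_sum {Q : ℤ⟦X⟧} (hQ : constantCoeff Q = 1) {i N : ℕ} (hi : i < N) :
    coeff i (F Q) = coeff i (∑ n ∈ Finset.range N, qPoch Q Q n) := by
  have h := (PowerSeries.WithPiTopology.hasSum_iff_hasSum_coeff ℤ).mp (hasSum_F hQ) i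
  rw [map_sum]
  refine h.unique (hasSum_sum_of_ne_finset_zero fun n hn => ?_)
  rw [Finset.mem_range, not_lt] at hn
  exact X_pow_dvd_iff.mp (X_pow_dvd_qPoch hQ n) i (by omega)

theorem coeff_one_sub_X_pow {R : Type*} [CommRing R] (e i : ℕ) :
    coeff i ((1 - X : R⟦X⟧) ^ e) = (-1) ^ i * (e.choose i : R) := by
  have h : (1 - X : R⟦X⟧) ^ e =
      rescale (-1) (((1 + Polynomial.X) ^ e : Polynomial R) : R⟦X⟧) := by
    simp [rescale_X, sub_eq_add_neg]
  rw [h, coeff_rescale, Polynomial.coeff_coe, Polynomial.coeff_one_add_X_pow]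

/-- Modulo `p`, for exponents below `N = p ^ a`, the numbers `ξ_r` are given by a finite sum of
binomial coefficients. -/
theorem two_mul_xi_cast {p : ℕ} [Fact p.Prime] (hp : Odd p) {r : ℤ} {a s i : ℕ} (ha : a ≠ 0)
    (hs : (s : ℤ) ≡ r [ZMOD (p ^ a : ℕ)]) (hi : i < p ^ a) :
    (2 : ZMod p) * (xi r i : ZMod p) = ∑ k ∈ Finset.range (p ^ a),
      (-1) ^ k * (6 * k + 5 : ZMod p) *
        ((-1) ^ i * ((s * ((k + 1) * (3 * k + 2) / 2)).choose i : ℕ)) := by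
  set N := p ^ a with hNdef
  have hN : Odd N := hp.pow
  let π : (ZMod p)⟦X⟧ →+* (ZMod p)⟦X⟧ ⧸ Ideal.span {(X : (ZMod p)⟦X⟧) ^ N} := Ideal.Quotient.mk _
  let φ : ℤ⟦X⟧ →+* (ZMod p)⟦X⟧ := PowerSeries.map (Int.castRingHom (ZMod p))
  set Q : ℤ⟦X⟧ := ((oneSubX ^ r : (ℤ⟦X⟧)ˣ) : ℤ⟦X⟧) with hQdef
  let u := Units.map (π.comp φ).toMonoidHom oneSubX
  have hu : (u : (ZMod p)⟦X⟧ ⧸ Ideal.span {(X : (ZMod p)⟦X⟧) ^ N}) = π (1 - X) := by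
    simp [u, oneSubX, φ]
  have huN : u ^ N = 1 := by
    have : CharP (ZMod p)⟦X⟧ p := charP_of_injective_ringHom (f := C (R := ZMod p)) C_injective p
    ext
    have hfrob : (1 - X : (ZMod p)⟦X⟧) ^ N = 1 - X ^ N := by
      rw [hNdef, sub_pow_char_pow, one_pow]
    rw [Units.val_pow_eq_pow_val, hu, ← map_pow, hfrob, map_sub, map_one, Units.val_one, sub_eq_self]
    exact Ideal.Quotient.eq_zero_iff_mem.mpr (Ideal.mem_span_singleton_self _)
  have hur : u ^ r = u ^ s := by
    obtain ⟨c, hc⟩ := hs.dvd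
    rw [← zpow_natCast u s, show r = s + (N : ℤ) * c by linarith, zpow_add, zpow_mul, zpow_natCast u N,
      huN, one_zpow, mul_one]
  have hQ : π (φ Q) = π ((1 - X) ^ s) := by
    have h : π (φ Q) = ((u ^ r : Units _) : _) := by
      rw [hQdef]; simp only [u, ← map_zpow]; rfl
    rw [h, hur, Units.val_pow_eq_pow_val, hu, map_pow]
  have hq : (π ((1 - X) ^ s)) ^ N = 1 := by
    rw [map_pow, ← hu, ← pow_mul, mul_comm, pow_mul, ← Units.val_pow_eq_pow_val, huN]
    simp
  have key := two_mul_sum_qPoch hN hq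
  have hkey : π (φ (2 * ∑ n ∈ Finset.range N, qPoch Q Q n)) =
      π (∑ k ∈ Finset.range N, C (((-1) ^ k * (6 * k + 5 - 3 * N) : ℤ) : ZMod p) *
        (1 - X) ^ (s * ((k + 1) * (3 * k + 2) / 2))) := by
    simp only [map_mul, map_sum, map_qPoch, map_ofNat, hQ]
    rw [key]
    refine Finset.sum_congr rfl fun k _ => ?_
    rw [map_intCast, map_intCast, pow_mul, map_pow]
    push_cast
    rfl
  rw [Ideal.Quotient.eq, Ideal.mem_span_singleton] at hkey
  have hcoe := X_pow_dvd_iff.mp hkey i hi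
  rw [map_sub, sub_eq_zero] at hcoe
  have h2 : coeff i (φ (2 * ∑ n ∈ Finset.range N, qPoch Q Q n)) = (2 : ZMod p) * (xi r i : ZMod p) := by
    rw [xi, coeff_F_eq_sum (constantCoeff_oneSubX_zpow r) hi, ← hQdef]
    simp only [φ, coeff_map, two_mul, map_add, eq_intCast]
  have hN0 : (N : ZMod p) = 0 := by
    rw [hNdef, Nat.cast_pow, ZMod.natCast_self, zero_pow ha]
  rw [← h2, hcoe, map_sum]
  refine Finset.sum_congr rfl fun k _ => ?_
  rw [coeff_C_mul, coeff_one_sub_X_pow]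
  push_cast
  rw [hN0, mul_zero, sub_zero]

theorem choose_mul_pentagonal_cast_eq_zero {p : ℕ} [Fact p.Prime] {r : ℤ}
    (hrp : IsCoprime r (p : ℤ)) {m : ℕ} (hm : m ∈ TStar p r 0) {s : ℕ} (hs : (s : ℤ) ≡ r [ZMOD p]) (n : ℕ) {k : ℕ}
    (hk : (6 * k + 5 : ZMod p) ≠ 0) :
    (((s * ((k + 1) * (3 * k + 2) / 2)).choose (p * n + m) : ℕ) : ZMod p) = 0 := by
  have hpos : 0 < p := (Fact.out : p.Prime).pos
  obtain ⟨e, he⟩ := two_dvd_pentagonal k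
  have hsr : (s : ZMod p) = (r : ZMod p) := by
    exact_mod_cast (ZMod.intCast_eq_intCast_iff _ _ _).mpr hs
  have hr0 : (r : ZMod p) ≠ 0 := by
    intro h
    obtain ⟨a, b, hab⟩ := hrp
    simpa [h] using congrArg (Int.cast : ℤ → ZMod p) hab
  rw [he, Nat.mul_div_cancel_left e two_pos]
  have hmem : s * e % p ∈ SStar p r 0 := by
    refine ⟨Nat.le_sub_one_of_lt (Nat.mod_lt _ hpos), ⟨k + 1, ?_⟩, ?_⟩
    · have h1 : ((k : ℤ) + 1) * (3 * (k + 1) - 1) / 2 = e := by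
        rw [show ((k : ℤ) + 1) * (3 * (k + 1) - 1) = 2 * e by
          rw [show (2 * e : ℤ) = ((2 * e : ℕ) : ℤ) by push_cast; rfl, ← he]; push_cast; ring]
        exact Int.mul_ediv_cancel_left _ two_ne_zero
      rw [h1, ← ZMod.intCast_eq_intCast_iff]
      push_cast [ZMod.natCast_mod]
      rw [hsr, sub_zero]
    · rw [← ZMod.intCast_eq_intCast_iff]
      push_cast [ZMod.natCast_mod]
      rw [hsr, sub_zero]
      intro h
      have he' : ((k : ZMod p) + 1) * (3 * k + 2) = 2 * e := by exact_mod_cast congrArg (Nat.cast : ℕ → ZMod p) he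
      -- Completing the square: `24 e + 1 = (6k + 5) ^ 2`.
      have h0 : (r : ZMod p) * (6 * k + 5) ^ 2 = 0 := by
        linear_combination h + 12 * r * he'
      exact (mul_ne_zero hr0 (pow_ne_zero 2 hk)) h0
  have hlt := hm.2 _ hmem
  have hmp : m < p := by have := hm.1; omega
  rw [(ZMod.natCast_eq_natCast_iff _ _ _).mpr
    (Choose.choose_modEq_choose_mod_mul_choose_div_nat (n := s * e) (k := p * n + m) (p := p)),
    Nat.mul_add_mod, Nat.mod_eq_of_lt hmp, Nat.choose_eq_zero_of_lt hlt, zero_mul, Nat.cast_zero]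

end Fishburn

theorem mainTheorem4 (p : ℕ) (hp : p.Prime) (hp5 : 5 ≤ p) (r : ℤ) (hr : r ≠ 0)
    (hrp : IsCoprime r (p : ℤ)) (m : ℕ) (hm : m ∈ Fishburn.TStar p r 0) (n : ℕ) :
    Fishburn.xi r (p * n + m) ≡ 0 [ZMOD (p : ℤ)] := by
  have : Fact p.Prime := ⟨hp⟩
  have hodd : Odd p := hp.odd_of_ne_two (by omega)
  obtain ⟨a, ha⟩ : ∃ a, p * n + m < p ^ (a + 1) :=
    ⟨p * n + m, (Nat.lt_pow_self hp.one_lt).trans (Nat.pow_lt_pow_succ hp.one_lt)⟩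
  have hpos : (0 : ℤ) < (p ^ (a + 1) : ℕ) := by exact_mod_cast pow_pos hp.pos _
  obtain ⟨s, hs⟩ := Int.eq_ofNat_of_zero_le (Int.emod_nonneg r hpos.ne')
  have hsr : (s : ℤ) ≡ r [ZMOD (p ^ (a + 1) : ℕ)] := by
    rw [← Int.ofNat_eq_natCast, ← hs]
    exact Int.mod_modEq _ _
  have hsp : (s : ℤ) ≡ r [ZMOD p] :=
    hsr.of_dvd (by exact_mod_cast dvd_pow_self p a.succ_ne_zero)
  have h := Fishburn.two_mul_xi_cast hodd a.succ_ne_zero hsr ha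
  rw [Finset.sum_eq_zero] at h
  · have h2 : (2 : ZMod p) ≠ 0 := by
      intro h2
      have h3 : p ∣ 2 := (ZMod.natCast_eq_zero_iff 2 p).mp (by exact_mod_cast h2)
      have := Nat.le_of_dvd two_pos h3
      omega
    have h3 := (mul_eq_zero.mp h).resolve_left h2
    rw [← ZMod.intCast_eq_intCast_iff, h3, Int.cast_zero]
  · intro k _
    by_cases hk : (6 * k + 5 : ZMod p) = 0
    · rw [hk]; ring
    · rw [Fishburn.choose_mul_pentagonal_cast_eq_zero hrp hm hsp n hk]; ring
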